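/- Let $K$ be a field, let $P=K[x_1,\dots,x_n]$, let $I\subset P$ be an ideal such that $R=P/I$ has Krull dimension $0$ (in particular $I\neq P$), and let $\mathcal F=(F_iR)_{i\in\mathbb Z}$ be the degree filtration of $R$, i.e. $F_iR$ is the image in $R$ of $F_iP=\{f\in P\mid \deg f\le i\}\cup\{0\}$. Let $\mathrm{HF}^a_R(i)=\dim_K F_iR$ be the affine Hilbert function, $\mathrm{ri}(R)=\min\{i\in\mathbb Z\mid \mathrm{HF}^a_R(j)=\dim_K R\text{ for all }j\ge i\}$ the regularity index, and $\Delta_R=\mathrm{HF}^a_R(\mathrm{ri}(R))-\mathrm{HF}^a_R(\mathrm{ri}(R)-1)$ the last difference. Let $\mathrm{gr}_{\mathcal F}(R)=\bigoplus_{i\in\mathbb Z}F_iR/F_{i-1}R$ be the associated graded ring, viewed as a $0$-dimensional affine $K$-algebra through $P\to \mathrm{gr}_{\mathcal F}(R)$, $x_k\mapsto \bar x_k+F_0R\in F_1R/F_0R$. Definitions. (1) $R$ is a *strict Gorenstein ring* if $\mathrm{gr}_{\mathcal F}(R)$ is a local Gorenstein ring, i.e. it is an Artinian local ring whose socle (the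 annihilator of the maximal ideal) is one-dimensional over the residue field. (2) Let $A$ be a $0$-dimensional affine $K$-algebra with a given presentation as a quotient of $P$ and the corresponding degree filtration, and let $\langle 0\rangle=\mathfrak q_1\cap\dots\cap\mathfrak q_s$ be the primary decomposition in $A$, with $\mathfrak m_i=\mathrm{Rad}(\mathfrak q_i)$. A *minimal divisor* at $\mathfrak m_i$ is an ideal $J=\mathfrak q_1\cap\dots\cap\mathfrak q_i'\cap\dots\cap\mathfrak q_s$ of $A$, where $\mathfrak q_i'\supsetneq\mathfrak q_i$ is an ideal ($\mathfrak q_i'=A$ is allowed), such that $\dim_K J=\dim_K A/\mathfrak m_i$. The order of $f\in A\setminus\{0\}$ is the $d\in\mathbb Z$ with $f\in F_dA\setminus F_{d-1}A$; $\mathrm{ri}(J)$ is the maximal order of a non-zero element of $J$, and $\mathrm{sepdeg}(\mathfrak m_i)$ is the minimum of $\mathrm{ri}(J)$ over all minimal divisors $J$ at $\mathfrak m_i$. The algebra $A$ has the *Cayley-Bacharach property* if $\mathrm{sepdeg}(\mathfrak m_i)=\mathrm{ri}(A)$ for $i=1,\dots,s$. (3) $R$ has the *strict Cayley-Bacharach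 property* if $\mathrm{gr}_{\mathcal F}(R)$ has the Cayley-Bacharach property. Theorem. The following conditions are equivalent: (a) $R$ is a strict Gorenstein ring. (b) $R$ has the strict Cayley-Bacharach property and $\Delta_R=1$. -/

import Mathlib

open scoped DirectSum

noncomputable section

namespace ZeroDimAffine

/-! ### Degree filtrations -/

section Filtration

variable {K : Type*} [Field K] {n : ℕ}

/-- The degree filtration of the polynomial ring `P = K[x_1, …, x_n]`:
`F_i P = {f ∈ P ∣ deg f ≤ i} ∪ {0}` for `i ∈ ℤ`. -/
def polyFiltration (K : Type*) [Field K] (n : ℕ) (i : ℤ) :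
    Submodule K (MvPolynomial (Fin n) K) where
  carrier := {f | f = 0 ∨ (f.totalDegree : ℤ) ≤ i}
  zero_mem' := Or.inl rfl
  add_mem' := by
    rintro f g hf hg
    rcases hf with rfl | hf
    · simpa using hg
    rcases hg with rfl | hg
    · rw [add_zero]; exact Or.inr hf
    · have := MvPolynomial.totalDegree_add f g
      exact Or.inr (by omega)
  smul_mem' := by
    rintro c f (rfl | hf)
    · exact Or.inl (smul_zero c)
    · have := MvPolynomial.totalDegree_smul_le c f
      exact Or.inr (by omega)

theorem one_mem_polyFiltration : (1 : MvPolynomial (Fin n) K) ∈ polyFiltration K n 0 :=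
  Or.inr (by simp)

theorem X_mem_polyFiltration (k : Fin n) :
    (MvPolynomial.X k : MvPolynomial (Fin n) K) ∈ polyFiltration K n 1 :=
  Or.inr (by simp)

theorem mul_mem_polyFiltration {i j : ℤ} {f g : MvPolynomial (Fin n) K}
    (hf : f ∈ polyFiltration K n i) (hg : g ∈ polyFiltration K n j) :
    f * g ∈ polyFiltration K n (i + j) := by
  rcases hf with rfl | hf
  · exact Or.inl (zero_mul g)
  rcases hg with rfl | hg
  · exact Or.inl (mul_zero f)
  · have := MvPolynomial.totalDegree_mul f g
    exact Or.inr (by omega)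

variable {A : Type*} [CommRing A] [Algebra K A]

/-- The degree filtration of an affine algebra `A` with the presentation `π : P → A`:
`F_i A` is the image of `F_i P`. For `A = P/I` it is `F_i P / (F_i P ∩ I)`. -/
def degFiltration (π : MvPolynomial (Fin n) K →ₐ[K] A) (i : ℤ) : Submodule K A :=
  (polyFiltration K n i).map π.toLinearMap

instance (π : MvPolynomial (Fin n) K →ₐ[K] A) : SetLike.GradedMonoid (degFiltration π) where
  one_mem := ⟨1, one_mem_polyFiltration, map_one π⟩
  mul_mem := by
    rintro i j _ _ ⟨f, hf, rfl⟩ ⟨g, hg, rfl⟩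
    exact ⟨f * g, mul_mem_polyFiltration hf hg, map_mul π f g⟩

end Filtration

/-! ### Invariants of a filtered algebra -/

section Invariants

variable {K : Type*} [Field K] {A : Type*} [CommRing A] [Algebra K A]

/-- The affine Hilbert function `HF^a(i) = dim_K F_i A`. -/
def affineHF (F : ℤ → Submodule K A) (i : ℤ) : ℤ :=
  Module.finrank K (F i)

/-- The regularity index `ri = min {i ∈ ℤ ∣ HF^a(j) = dim_K A for all j ≥ i}`. -/
def regIndex (F : ℤ → Submodule K A) : ℤ :=
  sInf {i : ℤ | ∀ j : ℤ, i ≤ j → affineHF F j = Module.finrank K A}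

/-- The last difference `Δ = HF^a(ri) - HF^a(ri - 1)`. -/
def lastDifference (F : ℤ → Submodule K A) : ℤ :=
  affineHF F (regIndex F) - affineHF F (regIndex F - 1)

/-- The order `min {i ∈ ℤ ∣ f ∈ F_i A \ F_{i-1} A}` of a non-zero element `f`. -/
def order (F : ℤ → Submodule K A) (f : A) : ℤ :=
  sInf {i : ℤ | f ∈ F i ∧ f ∉ F (i - 1)}

/-- The maximal order `ri(J)` of a non-zero element of the ideal `J`. -/
def idealRegIndex (F : ℤ → Submodule K A) (J : Ideal A) : ℤ :=
  sSup {d : ℤ | ∃ f ∈ J, f ≠ 0 ∧ order F f = d}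

open Classical in
/-- `J` is the image in `A` of a minimal divisor at the maximal ideal `m` of the defining ideal:
if `⟨0⟩ = q_1 ∩ ⋯ ∩ q_s` is the primary decomposition, and `q = q_i` is the component with
radical `m`, then `J = q_1 ∩ ⋯ ∩ q' ∩ ⋯ ∩ q_s`, where `q` is replaced by some ideal `q'`
strictly containing it (`q' = ⟨1⟩` is allowed), and `dim_K J = dim_K A/m`. -/
def IsMinimalDivisor (K : Type*) [Field K] {A : Type*} [CommRing A] [Algebra K A]
    (m J : Ideal A) : Prop :=
  ∃ t : Finset (Ideal A), Submodule.IsMinimalPrimaryDecomposition (⊥ : Ideal A) t ∧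
    ∃ q ∈ t, q.radical = m ∧
      (∃ q' : Ideal A, q < q' ∧ J = q' ⊓ (t.erase q).inf id) ∧
      Module.finrank K J = Module.finrank K (A ⧸ m)

/-- The separator degree of the maximal ideal `m`: the minimum of the numbers `ri(J)` over all
minimal divisors `J` at `m`. -/
def sepDegree (F : ℤ → Submodule K A) (m : Ideal A) : ℤ :=
  sInf {d : ℤ | ∃ J : Ideal A, IsMinimalDivisor K m J ∧ idealRegIndex F J = d}

/-- The Cayley-Bacharach property: all separator degrees are equal to the regularity index. -/
def HasCBP (F : ℤ → Submodule K A) : Prop :=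
  ∀ m : Ideal A, m.IsMaximal → sepDegree F m = regIndex F

end Invariants

/-! ### The associated graded ring of a `ℤ`-filtration -/

section Graded

variable {K : Type*} [Field K] {A : Type*} [CommRing A] [Algebra K A]

/-- The graded piece `F_i A / F_{i-1} A`. -/
def GrPiece (F : ℤ → Submodule K A) (i : ℤ) : Type _ :=
  F i ⧸ (F (i - 1)).submoduleOf (F i)

instance (F : ℤ → Submodule K A) (i : ℤ) : AddCommGroup (GrPiece F i) :=
  inferInstanceAs (AddCommGroup (F i ⧸ (F (i - 1)).submoduleOf (F i)))

instance (F : ℤ → Submodule K A) (i : ℤ) : Module K (GrPiece F i) :=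
  inferInstanceAs (Module K (F i ⧸ (F (i - 1)).submoduleOf (F i)))

/-- The residue class map `F_i A → F_i A / F_{i-1} A`. -/
def GrPiece.mk (F : ℤ → Submodule K A) (i : ℤ) : F i →ₗ[K] GrPiece F i :=
  ((F (i - 1)).submoduleOf (F i)).mkQ

variable {F : ℤ → Submodule K A}

theorem GrPiece.mk_surjective {i : ℤ} (a : GrPiece F i) : ∃ x : F i, GrPiece.mk F i x = a :=
  Submodule.mkQ_surjective _ a

theorem GrPiece.mk_eq_zero {i : ℤ} (x : F i) : GrPiece.mk F i x = 0 ↔ (x : A) ∈ F (i - 1) :=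
  Submodule.Quotient.mk_eq_zero _

theorem GrPiece.mk_congr {i j : ℤ} {x : F i} {y : F j} (hij : i = j) (hxy : (x : A) = y) :
    (GradedMonoid.mk i (GrPiece.mk F i x) : GradedMonoid (GrPiece F)) =
      GradedMonoid.mk j (GrPiece.mk F j y) := by
  subst hij
  rw [Subtype.ext hxy]

variable [SetLike.GradedMonoid F]

/-- The multiplication `F_i A × F_j A → F_{i+j} A` of `A`. -/
def filMul (F : ℤ → Submodule K A) [SetLike.GradedMonoid F] (i j : ℤ) :
    F i →ₗ[K] F j →ₗ[K] F (i + j) :=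
  LinearMap.mk₂ K (fun x y => ⟨(x : A) * y, SetLike.mul_mem_graded x.2 y.2⟩)
    (fun x x' y => Subtype.ext (add_mul (x : A) x' y))
    (fun c x y => Subtype.ext (smul_mul_assoc c (x : A) y))
    (fun x y y' => Subtype.ext (mul_add (x : A) y y'))
    (fun c x y => Subtype.ext (mul_smul_comm c (x : A) y))

theorem coe_filMul {i j : ℤ} (x : F i) (y : F j) : (filMul F i j x y : A) = x * y :=
  rfl

/-- The multiplication `(F_i A / F_{i-1} A) × (F_j A / F_{j-1} A) → F_{i+j} A / F_{i+j-1} A`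
induced by the multiplication of `A`. -/
def GrPiece.mul (F : ℤ → Submodule K A) [SetLike.GradedMonoid F] (i j : ℤ) :
    GrPiece F i →ₗ[K] GrPiece F j →ₗ[K] GrPiece F (i + j) :=
  Submodule.liftQ ((F (i - 1)).submoduleOf (F i))
    (LinearMap.flip
      (Submodule.liftQ ((F (j - 1)).submoduleOf (F j))
        ((filMul F i j).compr₂ (GrPiece.mk F (i + j))).flip
        (by
          intro y hy
          refine LinearMap.mem_ker.2 (LinearMap.ext fun x => (GrPiece.mk_eq_zero _).2 ?_)
          have h := SetLike.mul_mem_graded (A := F) x.2 (show (y : A) ∈ F (j - 1) from hy)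
          rwa [← add_sub_assoc] at h)))
    (by
      intro x hx
      refine LinearMap.mem_ker.2 (LinearMap.ext fun b => ?_)
      obtain ⟨y, rfl⟩ := Submodule.mkQ_surjective _ b
      refine (GrPiece.mk_eq_zero (filMul F i j x y)).2 ?_
      have h := SetLike.mul_mem_graded (A := F) (show (x : A) ∈ F (i - 1) from hx) y.2
      rwa [sub_add_eq_add_sub] at h)

theorem GrPiece.mul_mk {i j : ℤ} (x : F i) (y : F j) :
    GrPiece.mul F i j (GrPiece.mk F i x) (GrPiece.mk F j y) =
      GrPiece.mk F (i + j) (filMul F i j x y) :=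
  rfl

instance : GradedMonoid.GOne (GrPiece F) where
  one := GrPiece.mk F 0 ⟨1, SetLike.GradedOne.one_mem⟩

instance : GradedMonoid.GMul (GrPiece F) where
  mul {i j} a b := GrPiece.mul F i j a b

instance : GradedMonoid.GMonoid (GrPiece F) where
  one_mul := by
    rintro ⟨i, a⟩
    obtain ⟨x, rfl⟩ := GrPiece.mk_surjective a
    exact GrPiece.mk_congr (zero_add i) (one_mul (x : A))
  mul_one := by
    rintro ⟨i, a⟩
    obtain ⟨x, rfl⟩ := GrPiece.mk_surjective a
    exact GrPiece.mk_congr (add_zero i) (mul_one (x : A))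
  mul_assoc := by
    rintro ⟨i, a⟩ ⟨j, b⟩ ⟨k, c⟩
    obtain ⟨x, rfl⟩ := GrPiece.mk_surjective a
    obtain ⟨y, rfl⟩ := GrPiece.mk_surjective b
    obtain ⟨z, rfl⟩ := GrPiece.mk_surjective c
    exact GrPiece.mk_congr (add_assoc i j k) (mul_assoc (x : A) y z)

instance : DirectSum.GCommRing (GrPiece F) where
  mul_zero a := map_zero _
  zero_mul b := LinearMap.congr_fun (map_zero _) b
  mul_add a b c := map_add _ b c
  add_mul a b c := LinearMap.congr_fun (map_add _ a b) c
  mul_comm := by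
    rintro ⟨i, a⟩ ⟨j, b⟩
    obtain ⟨x, rfl⟩ := GrPiece.mk_surjective a
    obtain ⟨y, rfl⟩ := GrPiece.mk_surjective b
    exact GrPiece.mk_congr (add_comm i j) (mul_comm (x : A) y)
  natCast m := m • GrPiece.mk F 0 ⟨1, SetLike.GradedOne.one_mem⟩
  natCast_zero := zero_smul ℕ _
  natCast_succ m := succ_nsmul _ m
  intCast m := m • GrPiece.mk F 0 ⟨1, SetLike.GradedOne.one_mem⟩
  intCast_ofNat m := natCast_zsmul _ m
  intCast_negSucc_ofNat m := negSucc_zsmul _ m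

instance : DirectSum.GAlgebra K (GrPiece F) where
  toFun := ((GrPiece.mk F 0).comp
    (LinearMap.toSpanSingleton K (F 0) ⟨1, SetLike.GradedOne.one_mem⟩)).toAddMonoidHom
  map_one := congrArg (GrPiece.mk F 0) (one_smul K _)
  map_mul c d := GrPiece.mk_congr (add_zero 0).symm
    (show (c * d) • (1 : A) = c • (1 : A) * d • (1 : A) by rw [smul_mul_smul_comm, one_mul])
  commutes := by
    rintro c ⟨i, a⟩
    obtain ⟨x, rfl⟩ := GrPiece.mk_surjective a
    exact GrPiece.mk_congr (add_comm 0 i) (mul_comm (c • (1 : A)) x)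
  smul_def := by
    rintro c ⟨i, a⟩
    obtain ⟨x, rfl⟩ := GrPiece.mk_surjective a
    exact GrPiece.mk_congr (x := c • x) (zero_add i).symm (smul_one_mul c (x : A)).symm

end Graded

/-- The associated graded ring `gr_F(A) = ⨁_{i ∈ ℤ} F_i A / F_{i-1} A`. -/
abbrev Gr {K : Type*} [Field K] {A : Type*} [CommRing A] [Algebra K A]
    (F : ℤ → Submodule K A) : Type _ :=
  ⨁ i : ℤ, GrPiece F i

/-! ### Zero-dimensional Gorenstein local rings -/

/-- A zero-dimensional Gorenstein local ring: an Artinian local ring `(A, m)` whose socle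
`Soc(A) = Ann_A(m)` has dimension one over the residue field `A/m`. -/
structure IsZeroDimGorensteinLocal (A : Type*) [CommRing A] : Prop where
  artinian : IsArtinianRing A
  isLocal : IsLocalRing A
  socle : Module.finrank (A ⧸ IsLocalRing.maximalIdeal A)
    (Submodule.torsionBySet A A (IsLocalRing.maximalIdeal A : Set A)) = 1

/-! ### The algebra `R = P/I` and its graded ring -/

section Quotient

variable {K : Type*} [Field K] {n : ℕ} (I : Ideal (MvPolynomial (Fin n) K))

/-- The degree filtration of `R = P/I`. -/
abbrev quotFiltration : ℤ → Submodule K (MvPolynomial (Fin n) K ⧸ I) :=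
  degFiltration (Ideal.Quotient.mkₐ K I)

/-- The presentation `P → gr_F(R)`, sending `x_k` to the residue class in `F_1 R / F_0 R` of the
image of `x_k` in `R`. It identifies `gr_F(R)` with the quotient of `P` by the degree form ideal
of `I`. -/
def grPresentation : MvPolynomial (Fin n) K →ₐ[K] Gr (quotFiltration I) :=
  MvPolynomial.aeval fun k =>
    DirectSum.of (GrPiece (quotFiltration I)) 1
      (GrPiece.mk (quotFiltration I) 1
        ⟨Ideal.Quotient.mkₐ K I (MvPolynomial.X k),
          MvPolynomial.X k, X_mem_polyFiltration k, rfl⟩)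

/-- `R = P/I` is a strict Gorenstein ring: `gr_F(R)` is a local Gorenstein ring. -/
def IsStrictGorenstein : Prop :=
  IsZeroDimGorensteinLocal (Gr (quotFiltration I))

/-- `R = P/I` has the strict Cayley-Bacharach property: the affine algebra `gr_F(R)`, with its
degree filtration, has the Cayley-Bacharach property. -/
def HasStrictCBP : Prop :=
  HasCBP (degFiltration (grPresentation I))

end Quotient

end ZeroDimAffine

end

open scoped DirectSum

noncomputable section

namespace ZeroDimAffine

/-! ### The associated graded ring: locality, nilpotent maximal ideal, socle. -/

section GradedRing

variable {K : Type*} [Field K] {A : Type*} [CommRing A] [Algebra K A]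

/-! Write `G` for the graded ring, `S` for its socle and `r` for the regularity index. Since `G`
lives in degrees `0..r` and its degree-zero part is `K`, it is local with residue field `K`, and its
maximal ideal is the nilpotent part of positive degree. For degree reasons the nonzero top piece
`G_r` lies in `S`.

The minimal divisors of `G` are exactly the lines `K·v` with `0 ≠ v ∈ S` (`isMinimalDivisor_iff`),
and `ri(K·v)` is the order of `v`. So the separator degree is the least order of a nonzero socle
element, and it equals `r` iff the projection `S → G_r` is injective (`sepDegree_eq_iff`). This
projection is the identity on `G_r`, so the Cayley-Bacharach property says `S = G_r`. As `Δ_R = dim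
G_r` (`lastDifference_eq`), the property together with `Δ_R = 1` amounts to `dim S = 1`.

It remains to see that the degree filtration coming from the presentation of `G` is the filtration
by degree truncation (`degFiltration_grPresentation`). -/

/-- An increasing filtration which vanishes in negative degrees, consists of the constants in
degree zero, and becomes the whole algebra exactly in degree `r`. -/
structure IsConnectedFiltration (F : ℤ → Submodule K A) (r : ℤ) : Prop where
  mono : Monotone F
  neg : ∀ i < 0, F i = ⊥
  zero : ∀ a ∈ F 0, ∃ c : K, a = c • (1 : A)
  top : F r = ⊤
  ne_top : F (r - 1) ≠ ⊤

theorem affineHF_eq_finrank_iff [Module.Finite K A] (F : ℤ → Submodule K A) (i : ℤ) :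
    affineHF F i = Module.finrank K A ↔ F i = ⊤ := by
  unfold affineHF
  constructor
  · intro h
    exact Submodule.eq_top_of_finrank_eq (by exact_mod_cast h)
  · intro h
    rw [h, finrank_top]

theorem regIndex_eq [Module.Finite K A] {F : ℤ → Submodule K A} {r : ℤ} (hmono : Monotone F)
    (htop : F r = ⊤) (hne : F (r - 1) ≠ ⊤) : regIndex F = r := by
  have : {i : ℤ | ∀ j : ℤ, i ≤ j → affineHF F j = Module.finrank K A} = Set.Ici r := by
    ext i
    simp only [Set.mem_ofPred_eq, affineHF_eq_finrank_iff, Set.mem_Ici]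
    constructor
    · intro h
      by_contra hlt
      exact hne (h (r - 1) (by omega))
    · intro h j hj
      exact top_le_iff.1 (htop ▸ hmono (h.trans hj))
  rw [regIndex, this, csInf_Ici]

theorem lastDifference_eq [Module.Finite K A] {F : ℤ → Submodule K A} {r : ℤ}
    (hF : IsConnectedFiltration F r) :
    lastDifference F = Module.finrank K (GrPiece F r) := by
  have hle : F (r - 1) ≤ F r := hF.mono (by omega)
  have h := Submodule.finrank_quotient_add_finrank ((F (r - 1)).submoduleOf (F r))
  rw [(Submodule.submoduleOfEquivOfLe hle).finrank_eq] at h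
  rw [lastDifference, regIndex_eq hF.mono hF.top hF.ne_top, affineHF, affineHF, ← h]
  change _ = ((Module.finrank K (F r ⧸ (F (r - 1)).submoduleOf (F r)) : ℕ) : ℤ)
  push_cast
  ring

theorem GrPiece.forall_eq_zero_iff {F : ℤ → Submodule K A} {i : ℤ} :
    (∀ a : GrPiece F i, a = 0) ↔ F i ≤ F (i - 1) := by
  constructor
  · intro h x hx
    exact (GrPiece.mk_eq_zero ⟨x, hx⟩).1 (h _)
  · intro h a
    obtain ⟨x, rfl⟩ := GrPiece.mk_surjective a
    exact (GrPiece.mk_eq_zero x).2 (h x.2)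

theorem IsConnectedFiltration.grPiece_eq_zero_of_neg {F : ℤ → Submodule K A} {r i : ℤ}
    (hF : IsConnectedFiltration F r) (hi : i < 0) (a : GrPiece F i) : a = 0 :=
  GrPiece.forall_eq_zero_iff.2 (by rw [hF.neg i hi]; exact bot_le) a

theorem IsConnectedFiltration.grPiece_eq_zero_of_gt {F : ℤ → Submodule K A} {r i : ℤ}
    (hF : IsConnectedFiltration F r) (hi : r < i) (a : GrPiece F i) : a = 0 := by
  refine GrPiece.forall_eq_zero_iff.2 ?_ a
  have : F (i - 1) = ⊤ := top_le_iff.1 (hF.top ▸ hF.mono (by omega))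
  rw [this]
  exact le_top

theorem IsConnectedFiltration.exists_ne_zero {F : ℤ → Submodule K A} {r : ℤ}
    (hF : IsConnectedFiltration F r) : ∃ x : GrPiece F r, x ≠ 0 := by
  by_contra! h
  have := GrPiece.forall_eq_zero_iff.1 h
  rw [hF.top] at this
  exact hF.ne_top (top_le_iff.1 this)

/-- The elements of the associated graded ring which vanish in all degrees above `i`. -/
def grTrunc (F : ℤ → Submodule K A) (i : ℤ) : Submodule K (Gr F) where
  carrier := {g | ∀ j, i < j → g j = 0}
  zero_mem' := fun _ _ => rfl
  add_mem' := by
    intro a b ha hb j hj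
    rw [DirectSum.add_apply, ha j hj, hb j hj, add_zero]
  smul_mem' := by
    intro c a ha j hj
    rw [DirectSum.smul_apply, ha j hj, smul_zero]

theorem grTrunc_mono (F : ℤ → Submodule K A) : Monotone (grTrunc F) :=
  fun _ _ hij _ hg k hk => hg k (hij.trans_lt hk)

theorem of_mem_grTrunc {F : ℤ → Submodule K A} {i j : ℤ} (hij : j ≤ i) (a : GrPiece F j) :
    DirectSum.of (GrPiece F) j a ∈ grTrunc F i :=
  fun _ hk => DirectSum.of_eq_of_ne _ _ _ (by omega)

/-- The elements of the associated graded ring which vanish in all degrees below `i`. -/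
def grTail (F : ℤ → Submodule K A) (i : ℤ) : Submodule K (Gr F) where
  carrier := {g | ∀ j, j < i → g j = 0}
  zero_mem' := fun _ _ => rfl
  add_mem' := by
    intro a b ha hb j hj
    rw [DirectSum.add_apply, ha j hj, hb j hj, add_zero]
  smul_mem' := by
    intro c a ha j hj
    rw [DirectSum.smul_apply, ha j hj, smul_zero]

theorem of_mem_grTail {F : ℤ → Submodule K A} {i j : ℤ} (hij : i ≤ j) (a : GrPiece F j) :
    DirectSum.of (GrPiece F) j a ∈ grTail F i :=
  fun _ hk => DirectSum.of_eq_of_ne _ _ _ (by omega)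

variable {F : ℤ → Submodule K A} {r : ℤ}

theorem IsConnectedFiltration.grTrunc_top (hF : IsConnectedFiltration F r) :
    grTrunc F r = ⊤ :=
  top_le_iff.1 fun _ _ _ hj => hF.grPiece_eq_zero_of_gt hj _

theorem IsConnectedFiltration.grTrunc_ne_top (hF : IsConnectedFiltration F r) :
    grTrunc F (r - 1) ≠ ⊤ := by
  intro h
  obtain ⟨x, hx⟩ := hF.exists_ne_zero
  have : DirectSum.of (GrPiece F) r x ∈ grTrunc F (r - 1) := h ▸ Submodule.mem_top
  have := this r (by omega)
  rw [DirectSum.of_eq_same] at this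
  exact hx this

theorem IsConnectedFiltration.grTrunc_neg (hF : IsConnectedFiltration F r) {i : ℤ} (hi : i < 0) :
    grTrunc F i = ⊥ := by
  refine eq_bot_iff.2 fun g hg => (Submodule.mem_bot K).2 (DFinsupp.ext fun j => ?_)
  by_cases hj : j < 0
  · exact hF.grPiece_eq_zero_of_neg hj _
  · exact hg j (by omega)

theorem IsConnectedFiltration.mem_grTrunc_pred (hF : IsConnectedFiltration F r) {g : Gr F} :
    g ∈ grTrunc F (r - 1) ↔ g r = 0 := by
  constructor
  · intro h
    exact h r (by omega)
  · intro h j hj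
    rcases (show r ≤ j by omega).eq_or_lt with rfl | hj
    · exact h
    · exact hF.grPiece_eq_zero_of_gt hj _

theorem IsConnectedFiltration.eq_zero_of_mem_grTail (hF : IsConnectedFiltration F r) {i : ℤ}
    (hi : r < i) {g : Gr F} (hg : g ∈ grTail F i) : g = 0 := by
  refine DFinsupp.ext fun j => ?_
  by_cases hj : r < j
  · exact hF.grPiece_eq_zero_of_gt hj _
  · exact hg j (by omega)

theorem IsConnectedFiltration.finite_gr [Module.Finite K A] (hF : IsConnectedFiltration F r) :
    Module.Finite K (Gr F) := by
  have hfin (i : ℤ) : Module.Finite K (GrPiece F i) :=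
    inferInstanceAs (Module.Finite K (F i ⧸ (F (i - 1)).submoduleOf (F i)))
  let f : Gr F →ₗ[K] ((i : Finset.Icc (0 : ℤ) r) → GrPiece F i) :=
    LinearMap.pi fun i => DirectSum.component K ℤ (GrPiece F) i
  refine Module.Finite.of_injective f ((injective_iff_map_eq_zero f).2 fun g hg => ?_)
  refine DFinsupp.ext fun j => ?_
  by_cases hj : j < 0
  · exact hF.grPiece_eq_zero_of_neg hj _
  by_cases hj' : r < j
  · exact hF.grPiece_eq_zero_of_gt hj' _
  · exact congrFun hg ⟨j, Finset.mem_Icc.2 ⟨by omega, by omega⟩⟩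

theorem IsConnectedFiltration.mem_grTail_zero (hF : IsConnectedFiltration F r) (g : Gr F) :
    g ∈ grTail F 0 :=
  fun _ hj => hF.grPiece_eq_zero_of_neg hj _

variable [SetLike.GradedMonoid F]

theorem mul_mem_grTail {i j : ℤ} {a b : Gr F} (ha : a ∈ grTail F i) (hb : b ∈ grTail F j) :
    a * b ∈ grTail F (i + j) := by
  classical
  rw [DirectSum.mul_eq_sum_support_ghas_mul]
  refine Submodule.sum_mem _ fun p hp => of_mem_grTail ?_ _
  rw [Finset.mem_product, DFinsupp.mem_support_iff, DFinsupp.mem_support_iff] at hp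
  have h1 : i ≤ p.1 := by
    by_contra h
    exact hp.1 (ha _ (not_le.1 h))
  have h2 : j ≤ p.2 := by
    by_contra h
    exact hp.2 (hb _ (not_le.1 h))
  omega

theorem IsConnectedFiltration.isNilpotent (hF : IsConnectedFiltration F r) {g : Gr F}
    (hg : g ∈ grTail F 1) : IsNilpotent g := by
  have hpow : ∀ k : ℕ, g ^ k ∈ grTail F k := by
    intro k
    induction k with
    | zero => exact hF.mem_grTail_zero _
    | succ k ih =>
      rw [pow_succ, Nat.cast_succ]
      exact mul_mem_grTail ih hg
  -- The exponent only has to exceed `r`; using `toNat` avoids discussing the sign of `r`.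
  refine ⟨(r + 1).toNat, hF.eq_zero_of_mem_grTail ?_ (hpow _)⟩
  have := Int.self_le_toNat (r + 1)
  omega

theorem IsConnectedFiltration.nontrivial_gr (hF : IsConnectedFiltration F r) :
    Nontrivial (Gr F) := by
  obtain ⟨x, hx⟩ := hF.exists_ne_zero
  refine ⟨⟨DirectSum.of (GrPiece F) r x, 0, fun h => hx ?_⟩⟩
  have := congrArg (fun g : Gr F => g r) h
  simpa [DirectSum.of_eq_same] using this

/-- The degree-zero component is a scalar because `F 0` consists of constants. This makes `K` the
residue field. -/
theorem IsConnectedFiltration.exists_sub_mem (hF : IsConnectedFiltration F r) (g : Gr F) :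
    ∃ c : K, g - algebraMap K (Gr F) c ∈ grTail F 1 := by
  obtain ⟨x, hx⟩ := GrPiece.mk_surjective (g 0)
  obtain ⟨c, hc⟩ := hF.zero x x.2
  refine ⟨c, fun j hj => ?_⟩
  rcases (show j ≤ 0 by omega).eq_or_lt with rfl | hj
  · rw [DirectSum.sub_apply, sub_eq_zero, ← hx, DirectSum.algebraMap_apply, DirectSum.of_eq_same]
    exact congrArg (GrPiece.mk F 0) (Subtype.ext hc)
  · exact hF.grPiece_eq_zero_of_neg hj _

/-- A nonzero scalar plus a nilpotent is a unit. -/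
theorem IsConnectedFiltration.mem_nonunits_iff (hF : IsConnectedFiltration F r) {g : Gr F} :
    g ∈ nonunits (Gr F) ↔ g ∈ grTail F 1 := by
  have := hF.nontrivial_gr
  constructor
  · intro h
    obtain ⟨c, hc⟩ := hF.exists_sub_mem g
    by_cases h0 : c = 0
    · simpa [h0] using hc
    · refine absurd ?_ h
      have hu : IsUnit (algebraMap K (Gr F) c) := (isUnit_iff_ne_zero.2 h0).map _
      have := (hF.isNilpotent hc).isUnit_add_right_of_commute hu (Commute.all _ _)
      simpa using this
  · intro h hu
    obtain ⟨k, hk⟩ := hF.isNilpotent h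
    exact not_isUnit_zero (hk ▸ hu.pow k)

theorem IsConnectedFiltration.isLocalRing_gr (hF : IsConnectedFiltration F r) :
    IsLocalRing (Gr F) := by
  have := hF.nontrivial_gr
  refine IsLocalRing.of_nonunits_add fun a b ha hb => ?_
  rw [hF.mem_nonunits_iff] at ha hb ⊢
  exact add_mem ha hb

theorem IsConnectedFiltration.mem_maximalIdeal_iff [IsLocalRing (Gr F)]
    (hF : IsConnectedFiltration F r) {g : Gr F} :
    g ∈ IsLocalRing.maximalIdeal (Gr F) ↔ g ∈ grTail F 1 := by
  rw [IsLocalRing.mem_maximalIdeal, hF.mem_nonunits_iff]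

theorem IsConnectedFiltration.finrank_residueField [IsLocalRing (Gr F)]
    (hF : IsConnectedFiltration F r) :
    Module.finrank K (Gr F ⧸ IsLocalRing.maximalIdeal (Gr F)) = 1 := by
  refine (finrank_eq_one_iff' (K := K)).2 ⟨1, one_ne_zero, fun w => ?_⟩
  obtain ⟨g, rfl⟩ := Ideal.Quotient.mk_surjective w
  obtain ⟨c, hc⟩ := hF.exists_sub_mem g
  refine ⟨c, ?_⟩
  rw [← Algebra.algebraMap_eq_smul_one, eq_comm]
  exact Ideal.Quotient.eq.2 (hF.mem_maximalIdeal_iff.2 hc)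

/-- The annihilator of the maximal ideal in the associated graded ring. -/
def grSocle (F : ℤ → Submodule K A) [SetLike.GradedMonoid F] : Submodule K (Gr F) where
  carrier := {g | ∀ h ∈ grTail F 1, h * g = 0}
  zero_mem' := fun _ _ => mul_zero _
  add_mem' := by
    intro a b ha hb h hh
    rw [mul_add, ha h hh, hb h hh, add_zero]
  smul_mem' := by
    intro c a ha h hh
    rw [mul_smul_comm, ha h hh, smul_zero]

theorem IsConnectedFiltration.of_mem_grSocle (hF : IsConnectedFiltration F r) (x : GrPiece F r) :
    DirectSum.of (GrPiece F) r x ∈ grSocle F :=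
  fun _ hh => hF.eq_zero_of_mem_grTail (by omega) (mul_mem_grTail hh (of_mem_grTail le_rfl x))

/-- The ring acts on its socle through the residue field `K`, so ideals inside the socle are just
`K`-subspaces. -/
theorem IsConnectedFiltration.exists_mul_eq_smul (hF : IsConnectedFiltration F r) (g : Gr F) :
    ∃ c : K, ∀ v ∈ grSocle F, g * v = c • v := by
  obtain ⟨c, hc⟩ := hF.exists_sub_mem g
  refine ⟨c, fun v hv => ?_⟩
  have := hv _ hc
  rwa [sub_mul, sub_eq_zero, ← Algebra.smul_def] at this

theorem IsConnectedFiltration.isZeroDimGorensteinLocal_iff [Module.Finite K A]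
    (hF : IsConnectedFiltration F r) :
    IsZeroDimGorensteinLocal (Gr F) ↔
      ∃ v ∈ grSocle F, v ≠ 0 ∧ ∀ w ∈ grSocle F, ∃ c : K, c • v = w := by
  have hloc := hF.isLocalRing_gr
  have hfin := hF.finite_gr
  have hsoc (g : Gr F) : g ∈ Submodule.torsionBySet (Gr F) (Gr F)
      (IsLocalRing.maximalIdeal (Gr F) : Set (Gr F)) ↔ g ∈ grSocle F := by
    rw [Submodule.mem_torsionBySet_iff]
    exact ⟨fun h a ha => h ⟨a, hF.mem_maximalIdeal_iff.2 ha⟩,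
      fun h a => h a (hF.mem_maximalIdeal_iff.1 a.2)⟩
  have key : Module.finrank (Gr F ⧸ IsLocalRing.maximalIdeal (Gr F))
      (Submodule.torsionBySet (Gr F) (Gr F) (IsLocalRing.maximalIdeal (Gr F) : Set (Gr F))) = 1 ↔
      ∃ v ∈ grSocle F, v ≠ 0 ∧ ∀ w ∈ grSocle F, ∃ c : K, c • v = w := by
    let _ : Field (Gr F ⧸ IsLocalRing.maximalIdeal (Gr F)) := Ideal.Quotient.field _
    refine (finrank_eq_one_iff' (K := Gr F ⧸ IsLocalRing.maximalIdeal (Gr F))).trans ?_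
    constructor
    · rintro ⟨v, hv, h⟩
      refine ⟨v, (hsoc _).1 v.2, fun h0 => hv (Subtype.ext h0), fun w hw => ?_⟩
      obtain ⟨c, hc⟩ := h ⟨w, (hsoc _).2 hw⟩
      obtain ⟨a, rfl⟩ := Ideal.Quotient.mk_surjective c
      obtain ⟨c, hc'⟩ := hF.exists_mul_eq_smul a
      refine ⟨c, ?_⟩
      rw [← hc' _ ((hsoc _).1 v.2)]
      exact congrArg Subtype.val hc
    · rintro ⟨v, hv, hv0, h⟩
      refine ⟨⟨v, (hsoc _).2 hv⟩, fun h0 => hv0 (congrArg Subtype.val h0), fun w => ?_⟩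
      obtain ⟨c, hc⟩ := h w ((hsoc _).1 w.2)
      refine ⟨Ideal.Quotient.mk _ (algebraMap K (Gr F) c), Subtype.ext ?_⟩
      rw [← hc, Algebra.smul_def]
      rfl
  exact ⟨fun h => key.1 h.socle, fun h => ⟨IsArtinianRing.of_finite K (Gr F), hloc, key.2 h⟩⟩

end GradedRing

/-! ### Minimal divisors as socle lines, separator degree, and the equivalence. -/

section MinimalDivisors

/-- In a local ring of dimension zero, the zero ideal is primary, and it is its own only minimal
primary decomposition. -/
theorem isMinimalPrimaryDecomposition_bot_iff {B : Type*} [CommRing B] [IsLocalRing B]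
    [Ring.KrullDimLE 0 B] {t : Finset (Ideal B)} :
    Submodule.IsMinimalPrimaryDecomposition (⊥ : Ideal B) t ↔ t = {⊥} := by
  classical
  have hrad {q : Ideal B} (hq : q.IsPrimary) : q.radical = IsLocalRing.maximalIdeal B :=
    have := Ideal.isPrime_radical hq
    IsLocalRing.eq_maximalIdeal (Ideal.isMaximal_of_isPrime _)
  -- The conditions on a minimal decomposition are phrased with radicals of colons; this turns them
  -- into radicals of the components.
  have hcolon (q : Ideal B) : q.colon (Set.univ : Set B) = q := by
    ext x
    rw [Submodule.mem_colon]
    exact ⟨fun h => by simpa using h 1 trivial, fun h p _ => q.mul_mem_right p h⟩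
  have hbot : (⊥ : Ideal B).IsPrimary := by
    refine Ideal.isPrimary_of_isMaximal_radical ?_
    have : (⊥ : Ideal B).radical = IsLocalRing.maximalIdeal B := by
      refine le_antisymm (IsLocalRing.le_maximalIdeal ?_) ?_
      · exact fun h => bot_ne_top (Ideal.radical_eq_top.1 h)
      · rw [Ideal.radical_eq_sInf]
        refine le_sInf fun p hp => ?_
        have := hp.2
        exact (IsLocalRing.eq_maximalIdeal (Ideal.isMaximal_of_isPrime p)).ge
    rw [this]
    infer_instance
  constructor
  · intro h
    -- All components have the maximal ideal as radical, while distinct components must have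
    -- distinct radicals.
    have hsub : (t : Set (Ideal B)).Subsingleton := by
      intro p hp q hq
      by_contra hne
      refine h.distinct hp hq hne ?_
      simp only [hcolon]
      rw [hrad (h.primary hp), hrad (h.primary hq)]
    rcases t.eq_empty_or_nonempty with rfl | ⟨q, hq⟩
    · have := h.inf_eq
      simp at this
    · have ht : t = {q} := by
        ext p
        rw [Finset.mem_singleton]
        exact ⟨fun hp => hsub hp hq, fun hp => hp ▸ hq⟩
      have := h.inf_eq
      rw [ht, Finset.inf_singleton] at this
      rw [ht]
      exact congrArg _ this
  · rintro rfl
    refine ⟨by simp, ?_, by simp, ?_⟩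
    · intro J hJ
      rw [Finset.mem_singleton.1 hJ]
      exact hbot
    · intro J hJ
      rw [Finset.mem_singleton.1 hJ]
      simp

variable {K : Type*} [Field K] {A : Type*} [CommRing A] [Algebra K A]
  {F : ℤ → Submodule K A} {r : ℤ} [SetLike.GradedMonoid F]

theorem IsConnectedFiltration.mem_span_singleton_iff (hF : IsConnectedFiltration F r) {v g : Gr F}
    (hv : v ∈ grSocle F) : g ∈ Ideal.span {v} ↔ ∃ c : K, c • v = g := by
  rw [Ideal.mem_span_singleton']
  constructor
  · rintro ⟨a, rfl⟩
    obtain ⟨c, hc⟩ := hF.exists_mul_eq_smul a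
    exact ⟨c, (hc v hv).symm⟩
  · rintro ⟨c, rfl⟩
    exact ⟨algebraMap K _ c, (Algebra.smul_def c v).symm⟩

/-- A nilpotent `g` acts on the stable line `K·v` with eigenvalue zero: if `g * v = c • v` with `c ≠
0`, then the unit `c - g` would kill `v`. -/
theorem IsConnectedFiltration.mem_grSocle_of_forall (hF : IsConnectedFiltration F r) {v : Gr F}
    (hv : v ≠ 0) (h : ∀ g : Gr F, ∃ c : K, c • v = g * v) : v ∈ grSocle F := by
  intro g hg
  obtain ⟨c, hc⟩ := h g
  by_cases h0 : c = 0
  · rw [← hc, h0, zero_smul]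
  · exfalso
    have hu : IsUnit (algebraMap K (Gr F) c) := (isUnit_iff_ne_zero.2 h0).map _
    have hu' := (hF.isNilpotent (neg_mem hg)).isUnit_add_right_of_commute hu (Commute.all _ _)
    refine hv (hu'.mul_right_eq_zero.1 ?_)
    rw [add_mul, ← Algebra.smul_def, hc, neg_mul, neg_add_cancel]

/-- The residue field is `K`, so the dimension condition alone makes `J` a line, and a line that is
an ideal lies in the socle. -/
theorem IsConnectedFiltration.isMinimalDivisor_iff [Module.Finite K A] [IsLocalRing (Gr F)]
    (hF : IsConnectedFiltration F r) {J : Ideal (Gr F)} :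
    IsMinimalDivisor K (IsLocalRing.maximalIdeal (Gr F)) J ↔
      ∃ v ∈ grSocle F, v ≠ 0 ∧ J = Ideal.span {v} := by
  classical
  have hfin := hF.finite_gr
  have : IsArtinianRing (Gr F) := IsArtinianRing.of_finite K (Gr F)
  constructor
  · rintro ⟨t, -, q, -, -, -, hJ⟩
    rw [hF.finrank_residueField] at hJ
    obtain ⟨v, hv0, hv⟩ := (finrank_eq_one_iff' (K := K)).1 hJ
    have hv0' : (v : Gr F) ≠ 0 := fun h => hv0 (Subtype.ext h)
    have hgen (w : Gr F) (hw : w ∈ J) : ∃ c : K, c • (v : Gr F) = w := by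
      obtain ⟨c, hc⟩ := hv ⟨w, hw⟩
      exact ⟨c, congrArg Subtype.val hc⟩
    have hsoc : (v : Gr F) ∈ grSocle F :=
      hF.mem_grSocle_of_forall hv0' fun g => hgen _ (J.mul_mem_left g v.2)
    refine ⟨v, hsoc, hv0', le_antisymm (fun w hw => ?_) ?_⟩
    · exact (hF.mem_span_singleton_iff hsoc).2 (hgen w hw)
    · exact (Ideal.span_singleton_le_iff_mem J).2 v.2
  · rintro ⟨v, hv, hv0, rfl⟩
    -- Erasing the only component leaves the empty infimum `⊤`, so `q'` can be `J` itself.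
    refine ⟨{⊥}, isMinimalPrimaryDecomposition_bot_iff.2 rfl, ⊥, Finset.mem_singleton_self _, ?_,
      ⟨Ideal.span {v}, ?_, by simp⟩, ?_⟩
    · refine le_antisymm (IsLocalRing.le_maximalIdeal fun h => ?_) fun g hg => ?_
      · exact bot_ne_top (Ideal.radical_eq_top.1 h)
      · obtain ⟨k, hk⟩ := hF.isNilpotent (hF.mem_maximalIdeal_iff.1 hg)
        exact ⟨k, by simp [hk]⟩
    · rw [bot_lt_iff_ne_bot, Ne, Ideal.span_singleton_eq_bot]
      exact hv0
    · rw [hF.finrank_residueField]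
      refine (finrank_eq_one_iff' (K := K)).2 ⟨⟨v, Ideal.mem_span_singleton_self v⟩,
        fun h => hv0 (congrArg Subtype.val h), fun w => ?_⟩
      obtain ⟨c, hc⟩ := (hF.mem_span_singleton_iff hv).1 w.2
      exact ⟨c, Subtype.ext hc⟩

theorem order_smul (W : ℤ → Submodule K A) {c : K} (hc : c ≠ 0) (a : A) :
    order W (c • a) = order W a := by
  simp only [order, Submodule.smul_mem_iff _ hc]

theorem IsConnectedFiltration.idealRegIndex_span (hF : IsConnectedFiltration F r) {v : Gr F}
    (hv : v ∈ grSocle F) (hv0 : v ≠ 0) (W : ℤ → Submodule K (Gr F)) :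
    idealRegIndex W (Ideal.span {v}) = order W v := by
  have : {d : ℤ | ∃ f ∈ Ideal.span {v}, f ≠ 0 ∧ order W f = d} = {order W v} := by
    ext d
    simp only [Set.mem_ofPred_eq, Set.mem_singleton_iff, hF.mem_span_singleton_iff hv]
    constructor
    · rintro ⟨_, ⟨c, rfl⟩, h0, rfl⟩
      exact order_smul W (fun hc => h0 (by rw [hc, zero_smul])) v
    · rintro rfl
      exact ⟨v, ⟨1, one_smul K v⟩, hv0, rfl⟩
  rw [idealRegIndex, this, csSup_singleton]

/-- The integer infimum in `order` is meaningful only for a nonempty set bounded below; here it is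
attained, between `0` and `r`. -/
theorem IsConnectedFiltration.order_mem (hF : IsConnectedFiltration F r) {v : Gr F} (hv : v ≠ 0) :
    0 ≤ order (grTrunc F) v ∧ order (grTrunc F) v ≤ r ∧
      v ∈ grTrunc F (order (grTrunc F) v) ∧ v ∉ grTrunc F (order (grTrunc F) v - 1) := by
  have hlow (i : ℤ) (hi : v ∈ grTrunc F i) : 0 ≤ i := by
    by_contra h
    rw [hF.grTrunc_neg (not_le.1 h)] at hi
    exact hv ((Submodule.mem_bot K).1 hi)
  have hbdd : BddBelow {i : ℤ | v ∈ grTrunc F i ∧ v ∉ grTrunc F (i - 1)} :=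
    ⟨0, fun i hi => hlow i hi.1⟩
  obtain ⟨d, hd, hmin⟩ := Int.exists_least_of_bdd (P := fun i => v ∈ grTrunc F i)
    ⟨0, hlow⟩ ⟨r, hF.grTrunc_top ▸ Submodule.mem_top⟩
  have hd' : d ∈ {i : ℤ | v ∈ grTrunc F i ∧ v ∉ grTrunc F (i - 1)} :=
    ⟨hd, fun h => by have := hmin _ h; omega⟩
  have hmem := Int.csInf_mem ⟨d, hd'⟩ hbdd
  exact ⟨hlow _ hmem.1, (csInf_le hbdd hd').trans
    (hmin r (hF.grTrunc_top ▸ Submodule.mem_top)), hmem.1, hmem.2⟩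

theorem IsConnectedFiltration.order_eq_iff (hF : IsConnectedFiltration F r) {v : Gr F}
    (hv : v ≠ 0) : order (grTrunc F) v = r ↔ v r ≠ 0 := by
  obtain ⟨-, hr, hmem, hnot⟩ := hF.order_mem hv
  constructor
  · intro h h0
    rw [h] at hnot
    exact hnot (hF.mem_grTrunc_pred.2 h0)
  · intro h
    by_contra hne
    have hlt : order (grTrunc F) v ≤ r - 1 := by omega
    exact h (hF.mem_grTrunc_pred.1 (grTrunc_mono F hlt hmem))

/-- No order exceeds `r`, so the minimum is `r` iff every nonzero socle element has order `r`. The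
top piece keeps the set of orders nonempty. -/
theorem IsConnectedFiltration.sepDegree_eq_iff [Module.Finite K A] [IsLocalRing (Gr F)]
    (hF : IsConnectedFiltration F r) :
    sepDegree (grTrunc F) (IsLocalRing.maximalIdeal (Gr F)) = r ↔
      ∀ v ∈ grSocle F, v ≠ 0 → v r ≠ 0 := by
  have hset : {d : ℤ | ∃ J : Ideal (Gr F), IsMinimalDivisor K (IsLocalRing.maximalIdeal (Gr F)) J ∧
      idealRegIndex (grTrunc F) J = d} =
      {d : ℤ | ∃ v ∈ grSocle F, v ≠ 0 ∧ order (grTrunc F) v = d} := by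
    ext d
    constructor
    · rintro ⟨J, hJ, rfl⟩
      obtain ⟨v, hv, hv0, rfl⟩ := hF.isMinimalDivisor_iff.1 hJ
      exact ⟨v, hv, hv0, (hF.idealRegIndex_span hv hv0 _).symm⟩
    · rintro ⟨v, hv, hv0, rfl⟩
      exact ⟨_, hF.isMinimalDivisor_iff.2 ⟨v, hv, hv0, rfl⟩, hF.idealRegIndex_span hv hv0 _⟩
  obtain ⟨x, hx⟩ := hF.exists_ne_zero
  have hx0 : DirectSum.of (GrPiece F) r x ≠ 0 := by
    intro h
    have := congrArg (fun g : Gr F => g r) h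
    rw [DirectSum.of_eq_same] at this
    exact hx this
  rw [sepDegree, hset]
  constructor
  · intro h v hv hv0
    have hbdd : BddBelow {d : ℤ | ∃ v ∈ grSocle F, v ≠ 0 ∧ order (grTrunc F) v = d} :=
      ⟨0, by rintro _ ⟨w, -, hw0, rfl⟩; exact (hF.order_mem hw0).1⟩
    exact (hF.order_eq_iff hv0).1
      (le_antisymm (hF.order_mem hv0).2.1 (h ▸ csInf_le hbdd ⟨v, hv, hv0, rfl⟩))
  · intro h
    have : {d : ℤ | ∃ v ∈ grSocle F, v ≠ 0 ∧ order (grTrunc F) v = d} = {r} := by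
      ext d
      constructor
      · rintro ⟨v, hv, hv0, rfl⟩
        exact (hF.order_eq_iff hv0).2 (h v hv hv0)
      · rintro rfl
        exact ⟨_, hF.of_mem_grSocle x, hx0, (hF.order_eq_iff hx0).2 (h _ (hF.of_mem_grSocle x) hx0)⟩
    rw [this, csInf_singleton]

theorem IsConnectedFiltration.hasCBP_grTrunc_iff [Module.Finite K A]
    (hF : IsConnectedFiltration F r) :
    HasCBP (grTrunc F) ↔ ∀ v ∈ grSocle F, v ≠ 0 → v r ≠ 0 := by
  have := hF.isLocalRing_gr
  have := hF.finite_gr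
  rw [← hF.sepDegree_eq_iff, HasCBP,
    regIndex_eq (grTrunc_mono F) hF.grTrunc_top hF.grTrunc_ne_top]
  constructor
  · intro h
    exact h _ inferInstance
  · intro h m hm
    rwa [IsLocalRing.eq_maximalIdeal hm]

/-- Linear algebra for the surjection from the socle to the top piece, `v ↦ v r`, whose injectivity
is the Cayley-Bacharach property. -/
theorem IsConnectedFiltration.isZeroDimGorensteinLocal_gr_iff [Module.Finite K A]
    (hF : IsConnectedFiltration F r) :
    IsZeroDimGorensteinLocal (Gr F) ↔ HasCBP (grTrunc F) ∧ lastDifference F = 1 := by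
  rw [hF.isZeroDimGorensteinLocal_iff, hF.hasCBP_grTrunc_iff, lastDifference_eq hF]
  norm_cast
  rw [finrank_eq_one_iff']
  have happly (c : K) (g : Gr F) : (c • g) r = c • g r := DirectSum.smul_apply c g r
  constructor
  · rintro ⟨v, -, -, hgen⟩
    have hgen' (y : GrPiece F r) : ∃ c : K, c • v r = y := by
      obtain ⟨c, hc⟩ := hgen _ (hF.of_mem_grSocle y)
      refine ⟨c, ?_⟩
      rw [← happly, hc, DirectSum.of_eq_same]
    have hvr : v r ≠ 0 := by
      intro h
      obtain ⟨x, hx⟩ := hF.exists_ne_zero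
      obtain ⟨c, rfl⟩ := hgen' x
      exact hx (by rw [h, smul_zero])
    refine ⟨fun w hw hw0 h => ?_, v r, hvr, hgen'⟩
    obtain ⟨c, rfl⟩ := hgen w hw
    rw [happly, smul_eq_zero] at h
    rcases h with rfl | h
    · exact hw0 (zero_smul K v)
    · exact hvr h
  · rintro ⟨h, x, hx, hgen⟩
    refine ⟨DirectSum.of (GrPiece F) r x, hF.of_mem_grSocle x, fun h0 => hx ?_, fun w hw => ?_⟩
    · have := congrArg (fun g : Gr F => g r) h0
      rwa [DirectSum.of_eq_same] at this
    · obtain ⟨c, hc⟩ := hgen (w r)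
      refine ⟨c, ?_⟩
      by_contra hne
      -- This difference is a socle element with zero top component, so injectivity forces it to
      -- vanish.
      refine h (c • DirectSum.of (GrPiece F) r x - w)
        (sub_mem (Submodule.smul_mem _ c (hF.of_mem_grSocle x)) hw) (sub_ne_zero.2 hne) ?_
      rw [DirectSum.sub_apply, happly, DirectSum.of_eq_same, hc, sub_self]

end MinimalDivisors

/-! ### The degree filtration of the graded ring under its presentation. -/

section Presentation

variable {K : Type*} [Field K] {n : ℕ}

theorem polyFiltration_mono : Monotone (polyFiltration K n) := by
  rintro i j hij f (rfl | hf)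
  · exact Or.inl rfl
  · exact Or.inr (hf.trans hij)

theorem degFiltration_mono {A : Type*} [CommRing A] [Algebra K A]
    (π : MvPolynomial (Fin n) K →ₐ[K] A) : Monotone (degFiltration π) :=
  fun _ _ hij => Submodule.map_mono (polyFiltration_mono hij)

theorem exists_isConnectedFiltration {A : Type*} [CommRing A] [Algebra K A] [Nontrivial A]
    [Module.Finite K A] {π : MvPolynomial (Fin n) K →ₐ[K] A} (hπ : Function.Surjective π) :
    ∃ r, IsConnectedFiltration (degFiltration π) r := by
  have hneg (i : ℤ) (hi : i < 0) : degFiltration π i = ⊥ := by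
    refine eq_bot_iff.2 ?_
    rintro _ ⟨f, rfl | hf, rfl⟩
    · simp
    · omega
  -- Lift a finite spanning set to polynomials and take the largest degree.
  have htop : ∃ i, degFiltration π i = ⊤ := by
    obtain ⟨s, hs⟩ := Module.Finite.fg_top (R := K) (M := A)
    choose f hf using hπ
    refine ⟨((s.sup fun a => (f a).totalDegree : ℕ) : ℤ), top_le_iff.1 ?_⟩
    rw [← hs, Submodule.span_le]
    intro a ha
    refine ⟨f a, Or.inr ?_, hf a⟩
    exact_mod_cast Finset.le_sup (f := fun a => (f a).totalDegree) ha
  obtain ⟨r, hr, hmin⟩ := Int.exists_least_of_bdd (P := fun i => degFiltration π i = ⊤)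
    ⟨0, fun i hi => by
      by_contra h
      rw [hneg i (not_le.1 h)] at hi
      exact bot_ne_top hi⟩ htop
  refine ⟨r, degFiltration_mono π, hneg, ?_, hr, fun h => ?_⟩
  · rintro _ ⟨f, rfl | hf, rfl⟩
    · exact ⟨0, by simp⟩
    · have h0 : f.totalDegree = 0 := by omega
      rw [MvPolynomial.totalDegree_eq_zero_iff_eq_C] at h0
      refine ⟨MvPolynomial.coeff 0 f, ?_⟩
      rw [← Algebra.algebraMap_eq_smul_one, ← π.commutes]
      exact congrArg π h0
  · have := hmin _ h
    omega

theorem mem_polyFiltration_of_isHomogeneous {f : MvPolynomial (Fin n) K} {d : ℕ}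
    (hf : f.IsHomogeneous d) : f ∈ polyFiltration K n d :=
  Or.inr (by exact_mod_cast hf.totalDegree_le)

variable (I : Ideal (MvPolynomial (Fin n) K))

/-- The residue class in `F_i R / F_{i-1} R` of a polynomial of degree at most `i`. -/
def polyToGrPiece (i : ℤ) : polyFiltration K n i →ₗ[K] GrPiece (quotFiltration I) i :=
  (GrPiece.mk (quotFiltration I) i).comp
    ((Ideal.Quotient.mkₐ K I).toLinearMap.restrict fun f hf => ⟨f, hf, rfl⟩)

theorem polyToGrPiece_surjective (i : ℤ) : Function.Surjective (polyToGrPiece I i) := by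
  intro a
  obtain ⟨⟨_, f, hf, rfl⟩, rfl⟩ := GrPiece.mk_surjective a
  exact ⟨⟨f, hf⟩, rfl⟩

theorem polyToGrPiece_eq_zero {i : ℤ} {f : polyFiltration K n i}
    (hf : (f : MvPolynomial (Fin n) K) ∈ polyFiltration K n (i - 1)) :
    polyToGrPiece I i f = 0 :=
  (GrPiece.mk_eq_zero _).2 ⟨f, hf, rfl⟩

/-- Transports classes between degrees that are equal only propositionally, such as `(s + t).degree`
and `s.degree + t.degree`. -/
theorem of_polyToGrPiece_congr {i j : ℤ} {f : polyFiltration K n i} {g : polyFiltration K n j}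
    (hij : i = j) (hfg : (f : MvPolynomial (Fin n) K) = g) :
    DirectSum.of (GrPiece (quotFiltration I)) i (polyToGrPiece I i f) =
      DirectSum.of (GrPiece (quotFiltration I)) j (polyToGrPiece I j g) := by
  subst hij
  rw [Subtype.ext hfg]

theorem of_polyToGrPiece_mul {i j : ℤ} (f : polyFiltration K n i) (g : polyFiltration K n j) :
    DirectSum.of (GrPiece (quotFiltration I)) i (polyToGrPiece I i f) *
        DirectSum.of (GrPiece (quotFiltration I)) j (polyToGrPiece I j g) =
      DirectSum.of (GrPiece (quotFiltration I)) (i + j)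
        (polyToGrPiece I (i + j) ⟨f * g, mul_mem_polyFiltration f.2 g.2⟩) :=
  DirectSum.of_mul_of _ _

theorem monomial_mem_polyFiltration (s : Fin n →₀ ℕ) (c : K) :
    MvPolynomial.monomial s c ∈ polyFiltration K n s.degree :=
  mem_polyFiltration_of_isHomogeneous (MvPolynomial.isHomogeneous_monomial c rfl)

theorem grPresentation_monomial (s : Fin n →₀ ℕ) (c : K) :
    grPresentation I (MvPolynomial.monomial s c) =
      DirectSum.of (GrPiece (quotFiltration I)) s.degree
        (polyToGrPiece I s.degree ⟨_, monomial_mem_polyFiltration s c⟩) := by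
  -- Closure under adding exponents serves both inductions below: over the variables and over the
  -- exponent of one variable.
  have hadd (s t : Fin n →₀ ℕ)
      (hs : ∀ c : K, grPresentation I (MvPolynomial.monomial s c) =
        DirectSum.of (GrPiece (quotFiltration I)) s.degree
          (polyToGrPiece I s.degree ⟨_, monomial_mem_polyFiltration s c⟩))
      (ht : ∀ c : K, grPresentation I (MvPolynomial.monomial t c) =
        DirectSum.of (GrPiece (quotFiltration I)) t.degree
          (polyToGrPiece I t.degree ⟨_, monomial_mem_polyFiltration t c⟩)) (c : K) :
      grPresentation I (MvPolynomial.monomial (s + t) c) =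
        DirectSum.of (GrPiece (quotFiltration I)) (s + t).degree
          (polyToGrPiece I (s + t).degree ⟨_, monomial_mem_polyFiltration (s + t) c⟩) := by
    have hmul : MvPolynomial.monomial (s + t) c =
        MvPolynomial.monomial s c * MvPolynomial.monomial t 1 := by
      rw [MvPolynomial.monomial_mul, mul_one]
    have h := congrArg (grPresentation I) hmul
    rw [map_mul, hs, ht, of_polyToGrPiece_mul] at h
    rw [h]
    exact of_polyToGrPiece_congr I (by rw [map_add, Nat.cast_add]) hmul.symm
  have hzero (c : K) : grPresentation I (MvPolynomial.monomial 0 c) =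
      DirectSum.of (GrPiece (quotFiltration I)) (0 : Fin n →₀ ℕ).degree
        (polyToGrPiece I _ ⟨_, monomial_mem_polyFiltration 0 c⟩) := by
    have h1 : grPresentation I (MvPolynomial.monomial 0 c) = algebraMap K _ c :=
      (grPresentation I).commutes c
    rw [h1, DirectSum.algebraMap_apply]
    have hC : MvPolynomial.C c ∈ polyFiltration K n 0 := Or.inr (by simp)
    refine Eq.trans ?_ (of_polyToGrPiece_congr I (f := ⟨MvPolynomial.C c, hC⟩) (by simp) rfl)
    refine congrArg (DirectSum.of (GrPiece (quotFiltration I)) 0)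
      (congrArg (GrPiece.mk (quotFiltration I) 0) (Subtype.ext ?_))
    exact (Algebra.algebraMap_eq_smul_one c).symm
  induction s using Finsupp.induction_linear generalizing c with
  | zero => exact hzero c
  | add s t hs ht => exact hadd s t hs ht c
  | single i m =>
    induction m generalizing c with
    | zero =>
      rw [Finsupp.single_zero]
      exact hzero c
    | succ m ih =>
      rw [Finsupp.single_add]
      refine hadd _ _ ih (fun c => ?_) c
      have hmul : MvPolynomial.monomial (Finsupp.single i 1) c =
          c • (MvPolynomial.X i : MvPolynomial (Fin n) K) := by
        rw [MvPolynomial.X, MvPolynomial.smul_monomial, smul_eq_mul, mul_one]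
      have hX : grPresentation I (MvPolynomial.X i) =
          DirectSum.of (GrPiece (quotFiltration I)) 1
            (polyToGrPiece I 1 ⟨MvPolynomial.X i, X_mem_polyFiltration i⟩) :=
        MvPolynomial.aeval_X _ i
      rw [congrArg (grPresentation I) hmul, map_smul, hX, ← DirectSum.of_smul, ← map_smul]
      exact of_polyToGrPiece_congr I (by simp) hmul.symm

theorem grPresentation_of_isHomogeneous {f : MvPolynomial (Fin n) K} {d : ℕ}
    (hf : f.IsHomogeneous d) :
    grPresentation I f = DirectSum.of (GrPiece (quotFiltration I)) d
      (polyToGrPiece I d ⟨f, mem_polyFiltration_of_isHomogeneous hf⟩) := by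
  have hdeg (s : f.support) : (s : Fin n →₀ ℕ).degree = d :=
    (Finsupp.degree_eq_weight_one (R := ℕ) ▸ hf (MvPolynomial.mem_support_iff.1 s.2) :)
  have hmem (s : f.support) :
      MvPolynomial.monomial (s : Fin n →₀ ℕ) (f.coeff s) ∈ polyFiltration K n d :=
    hdeg s ▸ monomial_mem_polyFiltration (s : Fin n →₀ ℕ) _
  have hsum : (⟨f, mem_polyFiltration_of_isHomogeneous hf⟩ : polyFiltration K n d) =
      ∑ s : f.support, ⟨_, hmem s⟩ := by
    refine Subtype.ext ?_
    rw [Submodule.coe_sum]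
    exact f.as_sum.trans (Finset.sum_coe_sort f.support
      fun s => MvPolynomial.monomial s (f.coeff s)).symm
  rw [hsum, map_sum, map_sum]
  conv_lhs => rw [f.as_sum, ← Finset.sum_coe_sort, map_sum]
  refine Finset.sum_congr rfl fun s _ => ?_
  rw [grPresentation_monomial]
  exact of_polyToGrPiece_congr I (by rw [hdeg s]) rfl

/-- Homogeneous forms of degree `d` map into degree `d`, which gives one inclusion. Conversely, a
class of degree `j` lifts to a polynomial of degree at most `j`, and its degree-`j` form already
maps to that class because lower terms die in the quotient. -/
theorem degFiltration_grPresentation :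
    degFiltration (grPresentation I) = grTrunc (quotFiltration I) := by
  classical
  ext i g
  constructor
  · rintro ⟨f, rfl | hf, rfl⟩
    · simp
    · rw [← f.sum_homogeneousComponent, map_sum]
      refine Submodule.sum_mem _ fun d hd => ?_
      change grPresentation I _ ∈ _
      rw [grPresentation_of_isHomogeneous I
        (MvPolynomial.homogeneousComponent_isHomogeneous d f)]
      refine of_mem_grTrunc ?_ _
      have := Finset.mem_range.1 hd
      omega
  · intro hg
    rw [← DirectSum.sum_support_of g]
    refine Submodule.sum_mem _ fun j hj => ?_
    have hji : j ≤ i := by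
      by_contra h
      exact DFinsupp.mem_support_iff.1 hj (hg j (not_le.1 h))
    refine degFiltration_mono _ hji ?_
    obtain ⟨⟨f, hf⟩, hfj⟩ := polyToGrPiece_surjective I j (g j)
    rw [← hfj]
    rcases hf with rfl | hf
    · have h0 : polyToGrPiece I j ⟨0, Or.inl rfl⟩ = 0 := map_zero _
      rw [h0, map_zero]
      exact zero_mem _
    obtain ⟨d, rfl⟩ : ∃ d : ℕ, j = d := ⟨j.toNat, by omega⟩
    have hhom := MvPolynomial.homogeneousComponent_isHomogeneous d f
    refine ⟨MvPolynomial.homogeneousComponent d f, mem_polyFiltration_of_isHomogeneous hhom, ?_⟩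
    change grPresentation I _ = _
    rw [grPresentation_of_isHomogeneous I hhom]
    refine congrArg _ ?_
    rw [← sub_eq_zero, ← map_sub]
    refine polyToGrPiece_eq_zero I ?_
    have hsum : f = ∑ k ∈ Finset.range d, MvPolynomial.homogeneousComponent k f +
        MvPolynomial.homogeneousComponent d f := by
      rw [← Finset.sum_range_succ]
      conv_lhs => rw [← f.sum_homogeneousComponent]
      -- The canonical sum stops at `f.totalDegree ≤ d`; the components added up to `d` are zero.
      refine Finset.sum_subset (Finset.range_mono (by omega)) fun k _ hk => ?_
      refine MvPolynomial.homogeneousComponent_eq_zero _ _ ?_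
      rw [Finset.mem_range] at hk
      omega
    have hdiff : MvPolynomial.homogeneousComponent d f - f =
        -∑ k ∈ Finset.range d, MvPolynomial.homogeneousComponent k f := by
      nth_rw 2 [hsum]
      ring
    change MvPolynomial.homogeneousComponent d f - f ∈ _
    rw [hdiff]
    refine neg_mem (Submodule.sum_mem _ fun k hk => ?_)
    have := Finset.mem_range.1 hk
    exact polyFiltration_mono (by omega) (mem_polyFiltration_of_isHomogeneous
      (MvPolynomial.homogeneousComponent_isHomogeneous k f))

end Presentation

end ZeroDimAffine

end

theorem theorem6p11 {K : Type*} [Field K] {n : ℕ} (I : Ideal (MvPolynomial (Fin n) K))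
    (hI : ringKrullDim (MvPolynomial (Fin n) K ⧸ I) = 0) :
    ZeroDimAffine.IsStrictGorenstein I ↔
      ZeroDimAffine.HasStrictCBP I ∧
        ZeroDimAffine.lastDifference (ZeroDimAffine.quotFiltration I) = 1 := by
  -- The zero ring has Krull dimension `⊥`, not `0`.
  have : Nontrivial (MvPolynomial (Fin n) K ⧸ I) := by
    by_contra h
    rw [not_nontrivial_iff_subsingleton] at h
    rw [ringKrullDim_eq_bot_of_subsingleton] at hI
    exact absurd hI (by simp)
  have : Ring.KrullDimLE 0 (MvPolynomial (Fin n) K ⧸ I) := Ring.krullDimLE_iff.2 (by simp [hI])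
  have : Module.Finite K (MvPolynomial (Fin n) K ⧸ I) := (Module.finite_iff_krullDimLE_zero _ _).2 this
  obtain ⟨r, hF⟩ := ZeroDimAffine.exists_isConnectedFiltration
    (π := Ideal.Quotient.mkₐ K I) (Ideal.Quotient.mkₐ_surjective K I)
  rw [ZeroDimAffine.HasStrictCBP, ZeroDimAffine.degFiltration_grPresentation]
  exact hF.isZeroDimGorensteinLocal_gr_iff
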